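/- Let $\mathbb{M}=(M_p)_{p\in\mathbb{N}_0}$ be a weight sequence, that is, a sequence of positive real numbers with $M_0=1$ which is logarithmically convex ($M_p^2\le M_{p-1}M_{p+1}$ for all $p\ge 1$) and whose quotients $m_p:=M_{p+1}/M_p$, $p\in\mathbb{N}_0$, tend to infinity. Put $$h_{\mathbb{M}}(t):=\inf_{p\in\mathbb{N}_0}M_pt^p,\qquad t>0,$$ and let $$\gamma(\mathbb{M}):=\sup\{\gamma>0:\ (m_p/(p+1)^{\gamma})_{p\in\mathbb{N}_0}\ \text{is almost increasing}\}\in[0,\infty]$$ (with $\sup\emptyset=0$), where a sequence $(c_p)_p$ is almost increasing if there is $a>0$ with $c_p\le a\,c_q$ for all $q\ge p\ge 0$. For $\gamma>0$ let $S_\gamma:=\{z\in\mathcal{R}:\ |\arg z|<\gamma\pi/2\}$, where $\mathcal{R}$ is the Riemann surface of the logarithm. Suppose that $\gamma(\mathbb{M})>0$. Then for every real $\gamma$ with $0<\gamma<\gamma(\mathbb{M})$ there exists an optimal $\{\mathbb{M}\}$-flat function in $S_\gamma$, that is, a holomorphic function $G\colon S_\gamma\to\mathbb{C}$ for which there are constants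 $K_1,K_2,K_3,K_4>0$ such that $$G(x)\in\mathbb{R}\ \text{ and }\ K_1h_{\mathbb{M}}(K_2x)\le G(x)\quad\text{for all } x>0,\qquad |G(z)|\le K_3h_{\mathbb{M}}(K_4|z|)\quad\text{for all } z\in S_\gamma.$$ -/

import Mathlib

open Filter

namespace FlatFunctions

noncomputable section

/-- The sequence of quotients `m_p = M_{p+1} / M_p`. -/
def quotients (M : ℕ → ℝ) (p : ℕ) : ℝ := M (p + 1) / M p

/-- A weight sequence: positive terms, `M_0 = 1`, logarithmically convex, and the sequence of
quotients tends to infinity. -/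
structure IsWeightSequence (M : ℕ → ℝ) : Prop where
  pos : ∀ p, 0 < M p
  zero_eq_one : M 0 = 1
  log_convex : ∀ p, M (p + 1) ^ 2 ≤ M p * M (p + 2)
  quotients_tendsto : Tendsto (quotients M) atTop atTop

/-- A sequence `c` is almost increasing if, for some `a > 0`, `c_p ≤ a c_q` whenever `p ≤ q`. -/
def AlmostIncreasing (c : ℕ → ℝ) : Prop :=
  ∃ a : ℝ, 0 < a ∧ ∀ p q : ℕ, p ≤ q → c p ≤ a * c q

/-- The index `γ(M) ∈ [0, ∞]`: the supremum of all `γ > 0` such that `m_p / (p + 1) ^ γ` is almost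
increasing (and `0` if there is no such `γ`). -/
def gammaIndex (M : ℕ → ℝ) : ENNReal :=
  sSup {x : ENNReal | ∃ γ : ℝ, 0 < γ ∧
    AlmostIncreasing (fun p : ℕ => quotients M p / ((p : ℝ) + 1) ^ γ) ∧ x = ENNReal.ofReal γ}

/-- The function `h_M(t) = inf_p M_p t ^ p`, used for `t > 0`, where the family is bounded below
by `0` when the terms of `M` are positive. -/
def hFun (M : ℕ → ℝ) (t : ℝ) : ℝ := ⨅ p : ℕ, M p * t ^ p

/-- The Riemann surface of the logarithm: its points are given by a modulus `r > 0` and an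
argument `θ ∈ ℝ` (not taken modulo `2π`). -/
@[ext]
structure LogSurface where
  modulus : ℝ
  arg : ℝ
  modulus_pos : 0 < modulus

namespace LogSurface

/-- The logarithm `log r + i θ`, a bijection onto `ℂ`; it is the global holomorphic coordinate
that defines the complex structure of the surface. -/
def logEquiv : LogSurface ≃ ℂ where
  toFun z := ⟨Real.log z.modulus, z.arg⟩
  invFun w := ⟨Real.exp w.re, w.im, Real.exp_pos _⟩
  left_inv z := by
    ext
    · exact Real.exp_log z.modulus_pos
    · rfl
  right_inv w := by
    apply Complex.ext
    · exact Real.log_exp w.re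
    · rfl

/-- The covering projection `(r, θ) ↦ r e^{iθ}` onto `ℂ \ {0}`. -/
def proj (z : LogSurface) : ℂ := (z.modulus : ℂ) * Complex.exp ((z.arg : ℂ) * Complex.I)

/-- In the coordinate `log`, the covering projection is the complex exponential. -/
theorem proj_logEquiv_symm (w : ℂ) : proj (logEquiv.symm w) = Complex.exp w := by
  conv_rhs => rw [← Complex.re_add_im w, Complex.exp_add]
  simp [proj, logEquiv]

/-- The point of the surface over the positive real number `x`, with argument `0`. -/
def ofPos (x : ℝ) (hx : 0 < x) : LogSurface := ⟨x, 0, hx⟩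

/-- The unbounded sector `S_γ = {z : |arg z| < γ π / 2}`, with opening `γ π` and bisected by
direction `0`, in the Riemann surface of the logarithm. -/
def sector (γ : ℝ) : Set LogSurface := {z | |z.arg| < γ * Real.pi / 2}

/-- Holomorphy on a subset of the Riemann surface of the logarithm, expressed in the global
coordinate `log`. -/
def HolomorphicOn (G : LogSurface → ℂ) (S : Set LogSurface) : Prop :=
  DifferentiableOn ℂ (fun w : ℂ => G (logEquiv.symm w)) (logEquiv.symm ⁻¹' S)

end LogSurface

/-- `G` is an optimal `{M}`-flat function in the sector `S_γ`. The inequality `K₁ h_M(K₂ x) ≤ G(x)`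
includes that `G(x)` is real. -/
structure IsOptimalFlat (M : ℕ → ℝ) (γ : ℝ) (G : LogSurface → ℂ) : Prop where
  holomorphic : LogSurface.HolomorphicOn G (LogSurface.sector γ)
  lower : ∃ K₁ K₂ : ℝ, 0 < K₁ ∧ 0 < K₂ ∧ ∀ (x : ℝ) (hx : 0 < x),
    (G (LogSurface.ofPos x hx)).im = 0 ∧
      K₁ * hFun M (K₂ * x) ≤ (G (LogSurface.ofPos x hx)).re
  upper : ∃ K₃ K₄ : ℝ, 0 < K₃ ∧ 0 < K₄ ∧ ∀ z ∈ LogSurface.sector γ,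
    ‖G z‖ ≤ K₃ * hFun M (K₄ * z.modulus)

end

end FlatFunctions

namespace FlatFunctions

/-! The flat function is `G(z) = ∏ (1 + (z m_p)^(-1/γ))^(-γ)`, written as the exponential of a sum
of principal logarithms. On `S_γ` every `u_p = (z m_p)^(-1/γ)` lies in the right half-plane, so the
logarithms are holomorphic and `|1 + u_p| ≥ max(1, |u_p|)`. Hence the first `n` factors contribute
at most `M_n |z|^n` and the others at most `1`, for every `n`; this is the upper bound
(`norm_flatFun_le`). For the lower bound at `x > 0` (`mul_hFun_le_flatFun`), cut the product at the
first `n` with `x m_n > 1`. Each earlier factor is at least `2^(-γ) x m_p`, and the tail costs at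
most `exp(-γ C (n + 1))`, because `∑_{p ≥ n} m_p^(-1/γ) ≤ C (n + 1) m_n^(-1/γ)`. This tail estimate,
which also gives convergence, is where `γ < γ(M)` enters. -/

theorem norm_log_one_add_le_norm {u : ℂ} (hu : 0 ≤ u.re) :
    ‖Complex.log (1 + u)‖ ≤ ‖u‖ := by
  have hconv : Convex ℝ {z : ℂ | (1 : ℝ) ≤ z.re} := convex_halfSpace_re_ge 1
  have h := hconv.norm_image_sub_le_of_norm_hasDerivWithin_le
    (s := {z : ℂ | (1 : ℝ) ≤ z.re}) (f := Complex.log) (f' := fun z => z⁻¹) (C := 1) (x := 1) (y := 1 + u)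
    (fun z hz => (Complex.hasDerivAt_log (Or.inl (lt_of_lt_of_le one_pos hz))).hasDerivWithinAt)
    (fun z hz => by
      rw [norm_inv]
      exact inv_le_one_of_one_le₀ (le_trans hz (Complex.re_le_norm z)))
    (show (1 : ℝ) ≤ (1 : ℂ).re by simp) (show (1 : ℝ) ≤ (1 + u).re by simpa using hu)
  simpa using h

theorem one_le_norm_one_add {u : ℂ} (hu : 0 ≤ u.re) : 1 ≤ ‖1 + u‖ :=
  le_trans (by simpa using hu) (Complex.re_le_norm (1 + u))

theorem norm_le_norm_one_add {u : ℂ} (hu : 0 ≤ u.re) : ‖u‖ ≤ ‖1 + u‖ := by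
  rw [Complex.norm_def, Complex.norm_def]
  apply Real.sqrt_le_sqrt
  simp only [Complex.normSq_apply, Complex.add_re, Complex.add_im, Complex.one_re, Complex.one_im]
  nlinarith

/-! ### Tail sums of `m_p^(-1/γ)`. -/

/-- A telescoping lower bound for the increments of `t ^ (1 - s)`. -/
theorem rpow_neg_le_sub_rpow {s t : ℝ} (hs : 1 < s) (ht : 1 ≤ t) :
    (s - 1) * 2 ^ (-s) * t ^ (-s) ≤ t ^ (1 - s) - (t + 1) ^ (1 - s) := by
  have ht0 : 0 < t := by linarith
  have ht1 : 0 < t + 1 := by linarith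
  have hlog : (t + 1)⁻¹ ≤ Real.log (t + 1) - Real.log t := by
    have h := Real.log_le_sub_one_of_pos (div_pos ht0 ht1)
    rw [Real.log_div ht0.ne' ht1.ne'] at h
    have h2 : t / (t + 1) - 1 = -(t + 1)⁻¹ := by field_simp; ring
    linarith
  have hfac : t ^ (1 - s) =
      (t + 1) ^ (1 - s) * Real.exp ((s - 1) * (Real.log (t + 1) - Real.log t)) := by
    rw [Real.rpow_def_of_pos ht0, Real.rpow_def_of_pos ht1, ← Real.exp_add]
    ring_nf
  have hexp : 1 + (s - 1) * (t + 1)⁻¹ ≤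
      Real.exp ((s - 1) * (Real.log (t + 1) - Real.log t)) := by
    have h := Real.add_one_le_exp ((s - 1) * (Real.log (t + 1) - Real.log t))
    have := mul_le_mul_of_nonneg_left hlog (by linarith : 0 ≤ s - 1)
    linarith
  have hpow : (t + 1) ^ (1 - s) * (t + 1)⁻¹ = (t + 1) ^ (-s) := by
    rw [← Real.rpow_neg_one, ← Real.rpow_add ht1]
    ring_nf
  have htwo : 2 ^ (-s) * t ^ (-s) ≤ (t + 1) ^ (-s) := by
    rw [← Real.mul_rpow (by norm_num) ht0.le]
    exact Real.rpow_le_rpow_of_nonpos ht1 (by linarith) (by linarith)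
  have hA : 0 < (t + 1) ^ (1 - s) := Real.rpow_pos_of_pos ht1 _
  have h1 := mul_le_mul_of_nonneg_left hexp hA.le
  have h2 := mul_le_mul_of_nonneg_left htwo (by linarith : 0 ≤ s - 1)
  rw [← hpow] at h2
  rw [hfac]
  linarith

theorem sum_rpow_neg_le {s : ℝ} (hs : 1 < s) (n N : ℕ) :
    (s - 1) * 2 ^ (-s) * ∑ k ∈ Finset.range N, ((k + n : ℕ) + 1 : ℝ) ^ (-s) ≤
      ((n : ℝ) + 1) ^ (1 - s) := by
  -- The subtracted end term makes the induction telescope.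
  have key : (s - 1) * 2 ^ (-s) * ∑ k ∈ Finset.range N, ((k + n : ℕ) + 1 : ℝ) ^ (-s) ≤
      ((n : ℝ) + 1) ^ (1 - s) - ((N + n : ℕ) + 1 : ℝ) ^ (1 - s) := by
    induction N with
    | zero => simp
    | succ N ih =>
      rw [Finset.sum_range_succ, mul_add]
      have h := rpow_neg_le_sub_rpow hs (t := ((N + n : ℕ) + 1 : ℝ))
        (by linarith [(N + n : ℕ).cast_nonneg (α := ℝ)])
      have e : (((N + 1 + n : ℕ) : ℝ) + 1) = ((N + n : ℕ) + 1 : ℝ) + 1 := by push_cast; ring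
      rw [e]
      linarith
  have : (0 : ℝ) ≤ ((N + n : ℕ) + 1 : ℝ) ^ (1 - s) := by positivity
  linarith

/-- If `b q * (q + 1) ^ s` is almost decreasing for some `s > 1`, then the tails of `∑ b q`
are controlled by `(n + 1) * b n`. -/
theorem exists_tail_le {b : ℕ → ℝ} (hb : ∀ p, 0 ≤ b p) {s A : ℝ} (hs : 1 < s) (hA : 0 < A)
    (h : ∀ n q : ℕ, n ≤ q → b q ≤ A * b n * (((n : ℝ) + 1) ^ s * ((q : ℝ) + 1) ^ (-s))) :
    Summable b ∧ ∃ C : ℝ, 0 < C ∧ ∀ n : ℕ, ∑' k, b (k + n) ≤ C * ((n : ℝ) + 1) * b n := by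
  set d : ℝ := (s - 1) * 2 ^ (-s) with hd
  have hd0 : 0 < d := mul_pos (by linarith) (by positivity)
  have hpart : ∀ n N : ℕ, ∑ k ∈ Finset.range N, b (k + n) ≤ A / d * ((n : ℝ) + 1) * b n := by
    intro n N
    have hn : (0 : ℝ) < (n : ℝ) + 1 := by positivity
    have h0 : 0 ≤ A * b n * ((n : ℝ) + 1) ^ s :=
      mul_nonneg (mul_nonneg hA.le (hb n)) (by positivity)
    have hsum := sum_rpow_neg_le hs n N
    rw [← hd, mul_comm, ← le_div_iff₀ hd0] at hsum
    calc ∑ k ∈ Finset.range N, b (k + n)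
        ≤ ∑ k ∈ Finset.range N, A * b n * ((n : ℝ) + 1) ^ s * ((k + n : ℕ) + 1 : ℝ) ^ (-s) :=
          Finset.sum_le_sum fun k _ => by
            rw [mul_assoc (A * b n)]
            exact h n (k + n) (by omega)
      _ = A * b n * ((n : ℝ) + 1) ^ s *
          ∑ k ∈ Finset.range N, ((k + n : ℕ) + 1 : ℝ) ^ (-s) := by rw [Finset.mul_sum]
      _ ≤ A * b n * ((n : ℝ) + 1) ^ s * (((n : ℝ) + 1) ^ (1 - s) / d) :=
          mul_le_mul_of_nonneg_left hsum h0
      _ = A / d * (((n : ℝ) + 1) ^ s * ((n : ℝ) + 1) ^ (1 - s)) * b n := by ring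
      _ = A / d * ((n : ℝ) + 1) * b n := by
          rw [← Real.rpow_add hn, add_sub_cancel, Real.rpow_one]
  exact ⟨summable_of_sum_range_le hb fun N => by simpa using hpart 0 N, A / d, by positivity,
    fun n => Real.tsum_le_of_sum_range_le (fun k => hb _) (hpart n)⟩

theorem IsWeightSequence.quotients_pos {M : ℕ → ℝ} (hM : IsWeightSequence M) (p : ℕ) :
    0 < quotients M p :=
  div_pos (hM.pos _) (hM.pos _)

theorem IsWeightSequence.prod_quotients {M : ℕ → ℝ} (hM : IsWeightSequence M) (n : ℕ) :
    ∏ p ∈ Finset.range n, quotients M p = M n := by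
  induction n with
  | zero => simp [hM.zero_eq_one]
  | succ n ih =>
    rw [Finset.prod_range_succ, ih, quotients, mul_div_cancel₀ _ (hM.pos n).ne']

theorem exists_almostIncreasing_of_lt_gammaIndex {M : ℕ → ℝ} {γ : ℝ}
    (h : ENNReal.ofReal γ < gammaIndex M) :
    ∃ g : ℝ, γ < g ∧ AlmostIncreasing (fun p : ℕ => quotients M p / ((p : ℝ) + 1) ^ g) := by
  obtain ⟨x, ⟨g, hg, hinc, rfl⟩, hlt⟩ := lt_sSup_iff.1 h
  exact ⟨g, (ENNReal.ofReal_lt_ofReal_iff hg).1 hlt, hinc⟩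

/-- The tail estimate for `∑ m_p ^ (-1 / γ)` when `γ` is below the index of the sequence. -/
theorem IsWeightSequence.exists_tail_quotients_le {M : ℕ → ℝ} (hM : IsWeightSequence M) {γ : ℝ}
    (hγ : 0 < γ) (h : ENNReal.ofReal γ < gammaIndex M) :
    Summable (fun p => quotients M p ^ (-γ⁻¹)) ∧ ∃ C : ℝ, 0 < C ∧ ∀ n : ℕ,
      ∑' k, quotients M (k + n) ^ (-γ⁻¹) ≤ C * ((n : ℝ) + 1) * quotients M n ^ (-γ⁻¹) := by
  obtain ⟨g, hg, a, ha, hinc⟩ := exists_almostIncreasing_of_lt_gammaIndex h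
  have hm := hM.quotients_pos
  -- The exponent `s = g / γ` exceeds `1` since `g` was chosen strictly above `γ`.
  refine exists_tail_le (b := fun p => quotients M p ^ (-γ⁻¹)) (s := g * γ⁻¹) (A := a ^ γ⁻¹)
    (fun p => (Real.rpow_pos_of_pos (hm p) _).le) ?_ (by positivity) fun n q hnq => ?_
  · rw [← div_eq_mul_inv, one_lt_div hγ]
    exact hg
  · have hn : (0 : ℝ) < (n : ℝ) + 1 := by positivity
    have hq : (0 : ℝ) < (q : ℝ) + 1 := by positivity
    have hmn := hm n
    have hmq := hm q
    have hng : 0 < ((n : ℝ) + 1) ^ g := Real.rpow_pos_of_pos hn _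
    have hqg : 0 < ((q : ℝ) + 1) ^ g := Real.rpow_pos_of_pos hq _
    have h1 : a⁻¹ * quotients M n * ((((n : ℝ) + 1) ^ g)⁻¹ * ((q : ℝ) + 1) ^ g) ≤
        quotients M q := by
      have := hinc n q hnq
      have h2 := mul_le_mul_of_nonneg_left this (by positivity : 0 ≤ a⁻¹ * ((q : ℝ) + 1) ^ g)
      calc _ = a⁻¹ * ((q : ℝ) + 1) ^ g * (quotients M n / ((n : ℝ) + 1) ^ g) := by ring
        _ ≤ _ := h2
        _ = quotients M q := by field_simp
    have h3 := Real.rpow_le_rpow_of_nonpos (by positivity) h1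
      (by simpa using hγ.le : -γ⁻¹ ≤ 0)
    refine h3.trans_eq ?_
    rw [Real.mul_rpow (by positivity) (by positivity), Real.mul_rpow (by positivity) hmn.le,
      Real.mul_rpow (by positivity) (by positivity), Real.inv_rpow ha.le, Real.rpow_neg ha.le,
      inv_inv, Real.inv_rpow hng.le, ← Real.rpow_mul hn.le, ← Real.rpow_mul hq.le,
      ← Real.rpow_neg hn.le]
    ring_nf

/-! ### The flat function: holomorphy and the two bounds. -/

/-- In the coordinate `w = log z`, the value of `(z m) ^ (-1 / γ)`. -/
noncomputable def rootTerm (γ m : ℝ) (w : ℂ) : ℂ := Complex.exp (-(w + Real.log m) / γ)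

/-- In the coordinate `w = log z`, the function `∏ (1 + (z m_p) ^ (-1 / γ)) ^ (-γ)`. -/
noncomputable def flatFun (M : ℕ → ℝ) (γ : ℝ) (w : ℂ) : ℂ :=
  Complex.exp (-(γ * ∑' p, Complex.log (1 + rootTerm γ (quotients M p) w)))

theorem norm_rootTerm {γ m : ℝ} (hm : 0 < m) (w : ℂ) :
    ‖rootTerm γ m w‖ = Real.exp (-w.re / γ) * m ^ (-γ⁻¹) := by
  rw [rootTerm, Complex.norm_exp, Complex.div_ofReal_re, Real.rpow_def_of_pos hm, ← Real.exp_add]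
  congr 1
  simp only [Complex.neg_re, Complex.add_re, Complex.ofReal_re]
  ring

theorem rootTerm_re_pos {γ m : ℝ} (hγ : 0 < γ) {w : ℂ} (hw : |w.im| < γ * Real.pi / 2) :
    0 < (rootTerm γ m w).re := by
  rw [rootTerm, Complex.exp_re]
  refine mul_pos (Real.exp_pos _) (Real.cos_pos_of_mem_Ioo ?_)
  rw [Complex.div_ofReal_im]
  simp only [Complex.neg_im, Complex.add_im, Complex.ofReal_im, add_zero]
  rw [abs_lt] at hw
  constructor
  · rw [lt_div_iff₀ hγ]; linarith
  · rw [div_lt_iff₀ hγ]; linarith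

theorem norm_log_rootTerm_le {γ m : ℝ} (hγ : 0 < γ) (hm : 0 < m) {w : ℂ}
    (hw : |w.im| < γ * Real.pi / 2) :
    ‖Complex.log (1 + rootTerm γ m w)‖ ≤ Real.exp (-w.re / γ) * m ^ (-γ⁻¹) :=
  (norm_log_one_add_le_norm (rootTerm_re_pos hγ hw).le).trans_eq (norm_rootTerm hm w)

section

variable {M : ℕ → ℝ} {γ : ℝ}

theorem summable_log_rootTerm (hM : IsWeightSequence M) (hγ : 0 < γ)
    (hs : Summable (fun p => quotients M p ^ (-γ⁻¹))) {w : ℂ} (hw : |w.im| < γ * Real.pi / 2) :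
    Summable (fun p => Complex.log (1 + rootTerm γ (quotients M p) w)) :=
  Summable.of_norm_bounded (hs.mul_left _)
    fun p => norm_log_rootTerm_le hγ (hM.quotients_pos p) hw

theorem differentiableOn_flatFun (hM : IsWeightSequence M) (hγ : 0 < γ)
    (hs : Summable (fun p => quotients M p ^ (-γ⁻¹))) :
    DifferentiableOn ℂ (flatFun M γ) {w : ℂ | |w.im| < γ * Real.pi / 2} := by
  intro w₀ hw₀
  -- The majorant `exp(-Re w / γ) m_p^(-1/γ)` is uniform only where `Re w` is bounded below, so
  -- holomorphy is proved locally.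
  set U : Set ℂ := {w : ℂ | |w.im| < γ * Real.pi / 2 ∧ w₀.re - 1 < w.re}
  have hU : IsOpen U :=
    (isOpen_lt (Complex.continuous_im.abs) continuous_const).inter
      (isOpen_lt continuous_const Complex.continuous_re)
  have hmem : w₀ ∈ U := ⟨hw₀, by simp⟩
  have hsum : DifferentiableOn ℂ
      (fun w => ∑' p, Complex.log (1 + rootTerm γ (quotients M p) w)) U := by
    refine Complex.differentiableOn_tsum_of_summable_norm
      (hs.mul_left (Real.exp (-(w₀.re - 1) / γ))) (fun p => ?_) hU fun p w hw => ?_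
    · have hd : Differentiable ℂ (fun w => 1 + rootTerm γ (quotients M p) w) := by
        unfold rootTerm
        fun_prop
      refine hd.differentiableOn.clog fun w hw => Or.inl ?_
      have := rootTerm_re_pos (m := quotients M p) hγ hw.1
      simp only [Complex.add_re, Complex.one_re]
      linarith
    · refine (norm_log_rootTerm_le hγ (hM.quotients_pos p) hw.1).trans ?_
      refine mul_le_mul_of_nonneg_right ?_ (Real.rpow_nonneg (hM.quotients_pos p).le _)
      have := hw.2
      gcongr
  have h := (hsum.const_mul (γ : ℂ)).neg.cexp
  exact (h.differentiableAt (hU.mem_nhds hmem)).differentiableWithinAt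

theorem norm_flatFun (hM : IsWeightSequence M) (hγ : 0 < γ)
    (hs : Summable (fun p => quotients M p ^ (-γ⁻¹))) {w : ℂ} (hw : |w.im| < γ * Real.pi / 2) :
    Summable (fun p => Real.log ‖1 + rootTerm γ (quotients M p) w‖) ∧
    ‖flatFun M γ w‖ =
      Real.exp (-(γ * ∑' p, Real.log ‖1 + rootTerm γ (quotients M p) w‖)) := by
  have h := Complex.hasSum_re (summable_log_rootTerm hM hγ hs hw).hasSum
  simp only [Complex.log_re] at h
  refine ⟨h.summable, ?_⟩
  rw [flatFun, Complex.norm_exp, Complex.neg_re, Complex.re_ofReal_mul, h.tsum_eq]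

theorem norm_flatFun_le (hM : IsWeightSequence M) (hγ : 0 < γ)
    (hs : Summable (fun p => quotients M p ^ (-γ⁻¹))) {w : ℂ} (hw : |w.im| < γ * Real.pi / 2) :
    ‖flatFun M γ w‖ ≤ hFun M (Real.exp w.re) := by
  obtain ⟨hsum, hnorm⟩ := norm_flatFun hM hγ hs hw
  have hm := hM.quotients_pos
  have hre := fun p => (rootTerm_re_pos (m := quotients M p) hγ hw).le
  refine le_ciInf fun n => ?_
  have h1 : ∑ p ∈ Finset.range n, Real.log ‖1 + rootTerm γ (quotients M p) w‖ ≤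
      ∑' p, Real.log ‖1 + rootTerm γ (quotients M p) w‖ :=
    hsum.sum_le_tsum _ fun p _ => Real.log_nonneg (one_le_norm_one_add (hre p))
  -- Here `γ log |u_p| = -log (m_p |z|)`: the outer exponent `γ` cancels the root.
  have h2 : ∑ p ∈ Finset.range n, -(Real.log (quotients M p) + w.re) ≤
      γ * ∑ p ∈ Finset.range n, Real.log ‖1 + rootTerm γ (quotients M p) w‖ := by
    rw [Finset.mul_sum]
    refine Finset.sum_le_sum fun p _ => ?_
    have h3 : Real.log ‖rootTerm γ (quotients M p) w‖ ≤
        Real.log ‖1 + rootTerm γ (quotients M p) w‖ :=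
      Real.log_le_log (norm_pos_iff.2 (Complex.exp_ne_zero _)) (norm_le_norm_one_add (hre p))
    refine le_trans (le_of_eq ?_) (mul_le_mul_of_nonneg_left h3 hγ.le)
    rw [norm_rootTerm (hm p), Real.log_mul (Real.exp_pos _).ne'
      (Real.rpow_pos_of_pos (hm p) _).ne', Real.log_exp, Real.log_rpow (hm p)]
    field_simp
    ring
  have h4 : M n * Real.exp w.re ^ n =
      Real.exp (∑ p ∈ Finset.range n, (Real.log (quotients M p) + w.re)) := by
    rw [Real.exp_sum, ← hM.prod_quotients n]
    simp [Real.exp_add, Real.exp_log (hm _), Finset.prod_mul_distrib]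
  rw [hnorm, h4]
  refine Real.exp_le_exp.2 ?_
  rw [Finset.sum_neg_distrib] at h2
  have := mul_le_mul_of_nonneg_left h1 hγ.le
  linarith

theorem rootTerm_ofReal (m y : ℝ) :
    rootTerm γ m y = (Real.exp (-(y + Real.log m) / γ) : ℝ) := by
  rw [rootTerm]
  push_cast
  rfl

theorem flatFun_ofReal (y : ℝ) :
    flatFun M γ y = (Real.exp (-(γ * ∑' p,
      Real.log (1 + Real.exp (-(y + Real.log (quotients M p)) / γ)))) : ℝ) := by
  have h : ∀ p, Complex.log (1 + rootTerm γ (quotients M p) y) =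
      (Real.log (1 + Real.exp (-(y + Real.log (quotients M p)) / γ)) : ℝ) := fun p => by
    rw [rootTerm_ofReal, Complex.ofReal_log (by positivity), Complex.ofReal_add,
      Complex.ofReal_one]
  rw [flatFun, tsum_congr h, ← Complex.ofReal_tsum, Complex.ofReal_exp, Complex.ofReal_neg,
    Complex.ofReal_mul]

theorem mul_hFun_le_flatFun (hM : IsWeightSequence M) (hγ : 0 < γ)
    (hs : Summable (fun p => quotients M p ^ (-γ⁻¹))) {C : ℝ} (hC : 0 < C)
    (htail : ∀ n : ℕ,
      ∑' k, quotients M (k + n) ^ (-γ⁻¹) ≤ C * ((n : ℝ) + 1) * quotients M n ^ (-γ⁻¹)) (y : ℝ) :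
    Real.exp (-(γ * C)) * hFun M (Real.exp (-(γ * (Real.log 2 + C))) * Real.exp y) ≤
      (flatFun M γ y).re := by
  have hm := hM.quotients_pos
  set t : ℝ := Real.exp (-(γ * (Real.log 2 + C))) * Real.exp y with ht
  set L : ℕ → ℝ := fun p => Real.log (1 + Real.exp (-(y + Real.log (quotients M p)) / γ)) with hL
  have hE : ∀ p, Real.exp (-(y + Real.log (quotients M p)) / γ) =
      Real.exp (-y / γ) * quotients M p ^ (-γ⁻¹) := fun p => by
    rw [Real.rpow_def_of_pos (hm p), ← Real.exp_add]
    ring_nf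
  have hL0 : ∀ p, 0 ≤ L p := fun p =>
    Real.log_nonneg (by linarith [Real.exp_pos (-(y + Real.log (quotients M p)) / γ)])
  have hLle : ∀ p, L p ≤ Real.exp (-y / γ) * quotients M p ^ (-γ⁻¹) := fun p => by
    have := Real.log_le_sub_one_of_pos
      (by positivity : 0 < 1 + Real.exp (-(y + Real.log (quotients M p)) / γ))
    rw [← hE]
    linarith
  have hLs : Summable L := Summable.of_nonneg_of_le hL0 hLle (hs.mul_left _)
  have hex : ∃ n, 0 < y + Real.log (quotients M n) :=
    ((tendsto_atTop_add_const_left atTop y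
      (Real.tendsto_log_atTop.comp hM.quotients_tendsto)).eventually_gt_atTop 0).exists
  classical
  -- With `x = exp y`, minimality gives `x m_p ≤ 1`, hence `u_p ≥ 1` and `1 + u_p ≤ 2 u_p`, for all
  -- `p < n`.
  set n := Nat.find hex with hn
  have hn1 : 0 < y + Real.log (quotients M n) := Nat.find_spec hex
  have htl : ∑' k, L (k + n) ≤ C * ((n : ℝ) + 1) := by
    calc ∑' k, L (k + n) ≤ ∑' k, Real.exp (-y / γ) * quotients M (k + n) ^ (-γ⁻¹) :=
          Summable.tsum_le_tsum (fun k => hLle _) ((summable_nat_add_iff n).2 hLs)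
            (((summable_nat_add_iff n).2 hs).mul_left _)
      _ = Real.exp (-y / γ) * ∑' k, quotients M (k + n) ^ (-γ⁻¹) := tsum_mul_left
      _ ≤ Real.exp (-y / γ) * (C * ((n : ℝ) + 1) * quotients M n ^ (-γ⁻¹)) :=
          mul_le_mul_of_nonneg_left (htail n) (Real.exp_pos _).le
      _ = C * ((n : ℝ) + 1) * Real.exp (-(y + Real.log (quotients M n)) / γ) := by
          rw [hE]; ring
      _ ≤ C * ((n : ℝ) + 1) * 1 := by
          refine mul_le_mul_of_nonneg_left (Real.exp_le_one_iff.2 ?_) (by positivity)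
          exact div_nonpos_of_nonpos_of_nonneg (by linarith) hγ.le
      _ = C * ((n : ℝ) + 1) := mul_one _
  have hhead : γ * ∑ p ∈ Finset.range n, L p ≤
      ∑ p ∈ Finset.range n, (γ * Real.log 2 - (y + Real.log (quotients M p))) := by
    rw [Finset.mul_sum]
    refine Finset.sum_le_sum fun p hp => ?_
    have hp' : y + Real.log (quotients M p) ≤ 0 :=
      not_lt.1 (Nat.find_min hex (Finset.mem_range.1 hp))
    have h1 : (1 : ℝ) ≤ Real.exp (-(y + Real.log (quotients M p)) / γ) :=
      Real.one_le_exp (div_nonneg (by linarith) hγ.le)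
    have h2 : L p ≤ Real.log (2 * Real.exp (-(y + Real.log (quotients M p)) / γ)) :=
      Real.log_le_log (by positivity) (by linarith)
    rw [Real.log_mul two_ne_zero (Real.exp_pos _).ne', Real.log_exp] at h2
    have h3 := mul_le_mul_of_nonneg_left h2 hγ.le
    rw [mul_add, mul_div_cancel₀ _ hγ.ne'] at h3
    linarith
  have hMn : M n * t ^ n = Real.exp (∑ p ∈ Finset.range n,
      (-(γ * (Real.log 2 + C)) + (y + Real.log (quotients M p)))) := by
    rw [Real.exp_sum, ← hM.prod_quotients n, ht]
    simp only [Real.exp_add, Real.exp_log (hm _), Finset.prod_mul_distrib, Finset.prod_const,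
      Finset.card_range]
    ring
  have hh : hFun M t ≤ M n * t ^ n :=
    ciInf_le ⟨0, by
      rintro _ ⟨p, rfl⟩
      exact mul_nonneg (hM.pos p).le (pow_nonneg (by positivity) p)⟩ n
  rw [flatFun_ofReal, Complex.ofReal_re]
  refine (mul_le_mul_of_nonneg_left hh (Real.exp_pos _).le).trans ?_
  rw [hMn, ← Real.exp_add]
  refine Real.exp_le_exp.2 ?_
  rw [← hLs.sum_add_tsum_nat_add n]
  -- Of the loss `γ C (n + 1)`, the part `γ C n` and the `n` factors `2^(-γ)` are absorbed by `K₂ ^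
  -- n`; the remaining `γ C` is `K₁`'s exponent.
  have h5 := mul_le_mul_of_nonneg_left htl hγ.le
  simp only [Finset.sum_add_distrib, Finset.sum_sub_distrib, Finset.sum_const, Finset.card_range,
    nsmul_eq_mul] at hhead ⊢
  linarith

end

end FlatFunctions

theorem mainTheorem1 (M : ℕ → ℝ) (hM : FlatFunctions.IsWeightSequence M)
    (hpos : 0 < FlatFunctions.gammaIndex M) (γ : ℝ) (hγ : 0 < γ)
    (hγM : ENNReal.ofReal γ < FlatFunctions.gammaIndex M) :
    ∃ G : FlatFunctions.LogSurface → ℂ, FlatFunctions.IsOptimalFlat M γ G := by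
  obtain ⟨hs, C, hC, htail⟩ := hM.exists_tail_quotients_le hγ hγM
  refine ⟨fun z => FlatFunctions.flatFun M γ (FlatFunctions.LogSurface.logEquiv z), ?_, ?_, ?_⟩
  · unfold FlatFunctions.LogSurface.HolomorphicOn
    simp only [Equiv.apply_symm_apply]
    exact FlatFunctions.differentiableOn_flatFun hM hγ hs
  · refine ⟨Real.exp (-(γ * C)), Real.exp (-(γ * (Real.log 2 + C))), Real.exp_pos _,
      Real.exp_pos _, fun x hx => ?_⟩
    have hlog : FlatFunctions.LogSurface.logEquiv (FlatFunctions.LogSurface.ofPos x hx) =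
        (Real.log x : ℝ) := rfl
    have h := FlatFunctions.mul_hFun_le_flatFun hM hγ hs hC htail (Real.log x)
    rw [Real.exp_log hx] at h
    simp only [hlog]
    refine ⟨?_, h⟩
    rw [FlatFunctions.flatFun_ofReal, Complex.ofReal_im]
  · refine ⟨1, 1, one_pos, one_pos, fun z hz => ?_⟩
    have h := FlatFunctions.norm_flatFun_le hM hγ hs
      (w := FlatFunctions.LogSurface.logEquiv z) hz
    have hre : Real.exp (FlatFunctions.LogSurface.logEquiv z).re = z.modulus :=
      Real.exp_log z.modulus_pos
    rw [hre] at h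
    simpa using h
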